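/- Let $\mathcal C$ be a stable model category, i.e. a pointed model category for which the suspension functor $\Sigma$ is an equivalence of the homotopy category $Ho(\mathcal C)$; a cofibration $A\to B$ between cofibrant objects gives a cofiber triangle $A\to B\to B/A\to\Sigma A$ in $Ho(\mathcal C)$, and a cofiber triangle is any triangle isomorphic to one of these. Recall that $Ho(\mathcal C)$ is additive. For a chain complex $K_*=(\cdots\to K_1\to K_0)$ in $Ho(\mathcal C)$, let $F_mK_*$ be the part of $K_*$ in degrees $\le m$ (zero if $m<0$), and let $Gr^l_nFK_*=F_nK_*/F_{n-l}K_*$, the complex with the objects $K_k$, $n-l<k\le n$, and the differentials of $K_*$ between them. A totalization of $K_*$ is a sequence $T_0\to T_1\to\cdots$ in $Ho(\mathcal C)$ with maps $p_k:T_k\to\Sigma^kK_k$ such that $p_0$ is an isomorphism, and with attaching maps $a_k:\Sigma^kK_{k+1}\to T_k$ such that $p_k a_k=\Sigma^k d_{k+1}$ and $\Sigma^kK_{k+1}\xrightarrow{a_k}T_k\to T_{k+1}\xrightarrow{p_{k+1}}\Sigma^{k+1}K_{k+1}$ is a cofiber triangle for all $k\ge0$. Thus $T_k$ is filtered with subquotients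 $\Sigma^jK_j$, $j\le k$. For $K_*=Gr^l_nFC_*$ put $Tot(Gr^l_nFC_*)=T_n$, with the filtration by $T_0\to\cdots\to T_n$ (here $T_n\to T_{n+1}\to\cdots$ are isomorphisms). Let $f_\bullet:C_\bullet\to D_\bullet$ be a map of simplicial objects in $Ho(\mathcal C)$, and let $C_*$, $D_*$ be the chain complexes in $Ho(\mathcal C)$ given by the alternating sums of the face maps. Then for each $n\ge1$, and any totalizations $T^C_\bullet$ of $Gr^2_nFC_*$ and $T^D_\bullet$ of $Gr^2_nFD_*$, there is a filtration-preserving map $$h:Tot(Gr^2_nFC_*)\to Tot(Gr^2_nFD_*)$$ which agrees with $f_m$ on the subquotients $Gr^1_m=\Sigma^mC_m$ for $m=n,n-1$. More precisely, there are maps $h_k:T^C_k\to T^D_k$ for all $k\ge0$, with $h_n=h$, which commute with the transition maps $T_k\to T_{k+1}$, with the projections $p_k$ and with the attaching maps $a_k$, where $\Sigma^kGr^2_nFC_*\to\Sigma^kGr^2_nFD_*$ is given by $f_n$ and $f_{n-1}$; so $h_{k+1}$ is a map induced on the cofibers by the homotopy-commutative square formed by $a^C_k$, $a^D_k$, $h_k$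 and the $\Sigma^k$-suspension of the map $Gr^2_nFC_*\to Gr^2_nFD_*$ in degree $k+1$. If $f_m$ is a weak equivalence (i.e. an isomorphism in $Ho(\mathcal C)$) for every $m$, then $h$ can be chosen to be a weak equivalence as well. -/

import Mathlib

open CategoryTheory Limits HomotopicalAlgebra ZeroObject

namespace StableTot

section Cofibers

lemma isIso_map_of_weakEquivalence {C : Type*} [Category* C] [ModelCategory C]
    {H : Type*} [Category* H] (L : C ⥤ H) [L.IsLocalization (weakEquivalences C)]
    {X Y : C} (f : X ⟶ Y) [WeakEquivalence f] : IsIso (L.map f) :=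
  Localization.inverts L (weakEquivalences C) f ((weakEquivalence_iff f).1 inferInstance)

variable {C : Type*} [Category* C] [ModelCategory C] [HasZeroMorphisms C]

lemma weakEquivalence_cokernelMap_of_trivialCofibration {A K E : C} (i : A ⟶ K) (a : K ⟶ E)
    [Cofibration a] [WeakEquivalence a] :
    WeakEquivalence (cokernel.map i (i ≫ a) (𝟙 A) a (by simp)) := by
  have sq : IsPushout a (cokernel.π i) (cokernel.π (i ≫ a))
      (cokernel.map i (i ≫ a) (𝟙 A) a (by simp)) := by
    refine ⟨⟨by simp⟩, ⟨PushoutCocone.IsColimit.mk _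
      (fun s ↦ cokernel.desc _ s.inl ?_) ?_ ?_ ?_⟩⟩
    · rw [Category.assoc, s.condition, cokernel.condition_assoc, zero_comp]
    · intro s
      simp
    · intro s
      rw [← cancel_epi (cokernel.π i)]
      simp [s.condition]
    · intro s m hm _
      rw [← cancel_epi (cokernel.π (i ≫ a))]
      simpa using hm
  rw [weakEquivalence_iff]
  exact (MorphismProperty.of_isPushout (P := trivialCofibrations C) sq.flip
    (mem_trivialCofibrations a)).2

/-- A weak equivalence between two objects containing `A` through a cofibration induces a weak
equivalence on the quotients by `A`. -/
lemma weakEquivalence_cokernelMap_under {A K K' : C} (i : A ⟶ K) (i' : A ⟶ K')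
    [Cofibration i] [Cofibration i'] (r : K ⟶ K') [WeakEquivalence r] (w : i ≫ r = i') :
    WeakEquivalence (cokernel.map i i' (𝟙 A) r (by simp [w])) := by
  have fac := MorphismProperty.factorizationData (cofibrations C) (trivialFibrations C)
    (pushout.desc r (𝟙 K') (by simp [w]) : pushout i i' ⟶ K')
  let a : K ⟶ fac.Z := pushout.inl i i' ≫ fac.i
  let b : K' ⟶ fac.Z := pushout.inr i i' ≫ fac.i
  have : Cofibration fac.i := (cofibration_iff _).2 fac.hi
  have : WeakEquivalence fac.p := ((mem_trivialFibrations_iff _).1 fac.hp).2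
  have ha : a ≫ fac.p = r := by
    rw [Category.assoc, fac.fac]
    exact pushout.inl_desc _ _ _
  have hb : b ≫ fac.p = 𝟙 K' := by
    rw [Category.assoc, fac.fac]
    exact pushout.inr_desc _ _ _
  have : WeakEquivalence a := weakEquivalence_of_postcomp_of_fac ha
  have : WeakEquivalence b := weakEquivalence_of_postcomp_of_fac hb
  have hab : i' ≫ b = i ≫ a := by simp [a, b, pushout.condition_assoc]
  have h₁ := weakEquivalence_cokernelMap_of_trivialCofibration i a
  have h₂ := weakEquivalence_cokernelMap_of_trivialCofibration i' b
  have hp : (i' ≫ b) ≫ fac.p = i' := by rw [Category.assoc, hb, Category.comp_id]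
  have h₃ : cokernel.map i' (i' ≫ b) (𝟙 A) b (by simp) ≫
      cokernel.map (i' ≫ b) i' (𝟙 A) fac.p (by simp [hb]) = 𝟙 _ := by
    rw [← cancel_epi (cokernel.π i')]
    simp [reassoc_of% hb]
  have h₄ : WeakEquivalence (cokernel.map (i' ≫ b) i' (𝟙 A) fac.p (by simp [hb])) :=
    weakEquivalence_of_precomp_of_fac h₃
  have h₅ : cokernel.map i (i ≫ a) (𝟙 A) a (by simp) ≫
      (cokernel.map (i ≫ a) (i' ≫ b) (𝟙 A) (𝟙 _) (by simp [hab])) ≫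
      cokernel.map (i' ≫ b) i' (𝟙 A) fac.p (by simp [hb]) =
      cokernel.map i i' (𝟙 A) r (by simp [w]) := by
    rw [← cancel_epi (cokernel.π i)]
    simp [reassoc_of% ha]
  rw [← h₅]
  infer_instance

variable {H : Type*} [Category* H] (L : C ⥤ H) [L.IsLocalization (weakEquivalences C)]

variable [HasZeroObject C]

/-- Two extensions of the same map `A ⟶ A'` to a map from `K` to a fibrant contractible object
containing `A'` become equal in the homotopy category after passing to the quotients. -/
lemma map_cokernelMap_eq {A A' K K' : C} (i : A ⟶ K) (i' : A' ⟶ K') [Cofibration i]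
    [Fibration (0 : K' ⟶ 0)] [WeakEquivalence (0 : K' ⟶ 0)] (f : A ⟶ A') (g₀ g₁ : K ⟶ K')
    (h₀ : i ≫ g₀ = f ≫ i') (h₁ : i ≫ g₁ = f ≫ i') :
    L.map (cokernel.map i i' f g₀ h₀) = L.map (cokernel.map i i' f g₁ h₁) := by
  have fac := MorphismProperty.factorizationData (cofibrations C) (trivialFibrations C)
    (pushout.desc (𝟙 K) (𝟙 K) (by simp) : pushout i i ⟶ K)
  have : Cofibration fac.i := (cofibration_iff _).2 fac.hi
  have : WeakEquivalence fac.p := ((mem_trivialFibrations_iff _).1 fac.hp).2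
  let s₀ : K ⟶ fac.Z := pushout.inl i i ≫ fac.i
  let s₁ : K ⟶ fac.Z := pushout.inr i i ≫ fac.i
  have hs₀ : s₀ ≫ fac.p = 𝟙 K := by
    rw [Category.assoc, fac.fac]
    exact pushout.inl_desc _ _ _
  have hs₁ : s₁ ≫ fac.p = 𝟙 K := by
    rw [Category.assoc, fac.fac]
    exact pushout.inr_desc _ _ _
  have hs : i ≫ s₁ = i ≫ s₀ := by simp [s₀, s₁, pushout.condition_assoc]
  have sq : CommSq (pushout.desc g₀ g₁ (by rw [h₀, h₁])) fac.i (0 : K' ⟶ 0) 0 := ⟨by simp⟩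
  let G : fac.Z ⟶ K' := sq.lift
  have hG₀ : s₀ ≫ G = g₀ := by
    rw [Category.assoc, sq.fac_left]
    exact pushout.inl_desc _ _ _
  have hG₁ : s₁ ≫ G = g₁ := by
    rw [Category.assoc, sq.fac_left]
    exact pushout.inr_desc _ _ _
  have hr : (i ≫ s₀) ≫ fac.p = i := by rw [Category.assoc, hs₀, Category.comp_id]
  have : WeakEquivalence (cokernel.map (i ≫ s₀) i (𝟙 A) fac.p (by simp [hs₀])) :=
    weakEquivalence_cokernelMap_under _ _ fac.p hr
  have : IsIso (L.map (cokernel.map (i ≫ s₀) i (𝟙 A) fac.p (by simp [hs₀]))) :=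
    isIso_map_of_weakEquivalence L _
  have key : L.map (cokernel.map i (i ≫ s₀) (𝟙 A) s₀ (Category.id_comp _).symm) =
      L.map (cokernel.map i (i ≫ s₀) (𝟙 A) s₁ (by simp [hs])) := by
    rw [← cancel_mono (L.map (cokernel.map (i ≫ s₀) i (𝟙 A) fac.p (by simp [hs₀]))),
      ← L.map_comp, ← L.map_comp]
    congr 1
    rw [← cancel_epi (cokernel.π i)]
    simp [reassoc_of% hs₀, reassoc_of% hs₁]
  have e₀ : cokernel.map i i' f g₀ h₀ = cokernel.map i (i ≫ s₀) (𝟙 A) s₀ (by simp) ≫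
      cokernel.map (i ≫ s₀) i' f G (by rw [Category.assoc, hG₀, h₀]) := by
    rw [← cancel_epi (cokernel.π i)]
    simp [reassoc_of% hG₀]
  have e₁ : cokernel.map i i' f g₁ h₁ = cokernel.map i (i ≫ s₀) (𝟙 A) s₁ (by simp [hs]) ≫
      cokernel.map (i ≫ s₀) i' f G (by rw [Category.assoc, hG₀, h₀]) := by
    rw [← cancel_epi (cokernel.π i)]
    simp [reassoc_of% hG₁]
  rw [e₀, e₁, L.map_comp, L.map_comp, key]

end Cofibers

section Suspension

variable {C : Type*} [Category* C] [ModelCategory C] [HasZeroMorphisms C] [HasZeroObject C]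

/-- A cone on `A`: a cofibration from `A` to a weakly contractible object. -/
structure ConeOn (A : C) where
  /-- the underlying object -/
  obj : C
  /-- the inclusion of the base of the cone -/
  ι : A ⟶ obj
  cofibration_ι : Cofibration ι
  weakEquivalence_zero : WeakEquivalence (0 : obj ⟶ 0)

attribute [instance] ConeOn.cofibration_ι ConeOn.weakEquivalence_zero

/-- A cone on `A` which is moreover fibrant. -/
structure FibrantConeOn (A : C) extends ConeOn A where
  fibration_zero : Fibration (0 : obj ⟶ 0)

attribute [instance] FibrantConeOn.fibration_zero

instance (A : C) : Nonempty (FibrantConeOn A) := by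
  have fac := MorphismProperty.factorizationData (cofibrations C) (trivialFibrations C)
    (0 : A ⟶ 0)
  have hp : fac.p = 0 := (isZero_zero C).eq_of_tgt _ _
  have := (mem_trivialFibrations_iff _).1 fac.hp
  rw [hp] at this
  exact ⟨{ obj := fac.Z
           ι := fac.i
           cofibration_ι := (cofibration_iff _).2 fac.hi
           weakEquivalence_zero := this.2
           fibration_zero := this.1 }⟩

/-- A chosen fibrant cone on `A`. -/
noncomputable def stdCone (A : C) : FibrantConeOn A := Classical.arbitrary _

/-- The extension of a map `A ⟶ A'` to a map of cones. -/
lemma ConeOn.exists_map {A A' : C} (K : ConeOn A) (K' : FibrantConeOn A') (f : A ⟶ A') :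
    ∃ g : K.obj ⟶ K'.obj, K.ι ≫ g = f ≫ K'.ι := by
  have sq : CommSq (f ≫ K'.ι) K.ι (0 : K'.obj ⟶ 0) 0 := ⟨by simp⟩
  exact ⟨sq.lift, sq.fac_left⟩

/-- A chosen extension of a map `A ⟶ A'` to a map of cones. -/
noncomputable def ConeOn.map {A A' : C} (K : ConeOn A) (K' : FibrantConeOn A') (f : A ⟶ A') :
    K.obj ⟶ K'.obj := (K.exists_map K' f).choose

lemma ConeOn.ι_map {A A' : C} (K : ConeOn A) (K' : FibrantConeOn A') (f : A ⟶ A') :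
    K.ι ≫ K.map K' f = f ≫ K'.ι := (K.exists_map K' f).choose_spec

lemma ConeOn.weakEquivalence_of_map {A A' : C} (K : ConeOn A) (K' : ConeOn A')
    (g : K.obj ⟶ K'.obj) : WeakEquivalence g :=
  weakEquivalence_of_postcomp_of_fac (show g ≫ (0 : K'.obj ⟶ 0) = 0 by simp)

/-- The quotient `K / A` of a cone `K` on `A`: a model of the suspension of `A`. -/
noncomputable abbrev ConeOn.quot {A : C} (K : ConeOn A) : C := cokernel K.ι

/-- The map induced on quotients by a map of cones. -/
noncomputable def ConeOn.quotMap {A A' : C} (K : ConeOn A) (K' : FibrantConeOn A')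
    (f : A ⟶ A') : K.quot ⟶ K'.quot :=
  cokernel.map K.ι K'.ι f (K.map K' f) (K.ι_map K' f)

variable {H : Type*} [Category* H] (L : C ⥤ H) [L.IsLocalization (weakEquivalences C)]

lemma ConeOn.map_quotMap_eq {A A' : C} (K : ConeOn A) (K' : FibrantConeOn A') (f : A ⟶ A')
    (g : K.obj ⟶ K'.obj) (hg : K.ι ≫ g = f ≫ K'.ι) :
    L.map (K.quotMap K' f) = L.map (cokernel.map K.ι K'.ι f g hg) :=
  map_cokernelMap_eq L K.ι K'.ι f _ _ (K.ι_map K' f) hg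

lemma ConeOn.map_quotMap_comp {A A' A'' : C} (K : ConeOn A) (K' : FibrantConeOn A')
    (K'' : FibrantConeOn A'') (f : A ⟶ A') (f' : A' ⟶ A'') :
    L.map (K.quotMap K'' (f ≫ f')) =
      L.map (K.quotMap K' f) ≫ L.map (K'.quotMap K'' f') := by
  rw [← L.map_comp, K.map_quotMap_eq L K'' (f ≫ f') (K.map K' f ≫ K'.map K'' f')
    (by rw [reassoc_of% (K.ι_map K' f), ConeOn.ι_map, Category.assoc])]
  congr 1
  rw [← cancel_epi (cokernel.π K.ι)]
  simp [quotMap]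

lemma ConeOn.map_quotMap_id {A : C} (K : FibrantConeOn A) :
    L.map (K.quotMap K (𝟙 A)) = 𝟙 _ := by
  rw [ConeOn.map_quotMap_eq L _ K (𝟙 A) (𝟙 _) (by simp), ← L.map_id]
  congr 1
  rw [← cancel_epi (cokernel.π K.ι)]
  simp

instance ConeOn.isIso_map_quotMap {A : C} (K : ConeOn A) (K' : FibrantConeOn A) :
    IsIso (L.map (K.quotMap K' (𝟙 A))) := by
  have := K.weakEquivalence_of_map K'.toConeOn (K.map K' (𝟙 A))
  have : WeakEquivalence (K.quotMap K' (𝟙 A)) :=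
    weakEquivalence_cokernelMap_under _ _ _ (by simp [K.ι_map])
  exact isIso_map_of_weakEquivalence L _

lemma ConeOn.isIso_map_quotMap_of_trivialCofibration {A A' : C} (K : ConeOn A)
    (K' : FibrantConeOn A') (f : A ⟶ A') [Cofibration f] [WeakEquivalence f] :
    IsIso (L.map (K.quotMap K' f)) := by
  -- push the cone `K` out along `f`
  have : WeakEquivalence (0 : pushout K.ι f ⟶ 0) :=
    weakEquivalence_of_precomp_of_fac (show pushout.inl K.ι f ≫ 0 = (0 : K.obj ⟶ 0) by simp)
  let P : ConeOn A' :=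
    { obj := pushout K.ι f
      ι := pushout.inr _ _
      cofibration_ι := inferInstance
      weakEquivalence_zero := this }
  have : IsIso (cokernel.map K.ι (pushout.inr K.ι f) f (pushout.inl K.ι f)
      pushout.condition) :=
    isIso_cokernel_map_of_isPushout (IsPushout.of_hasPushout K.ι f)
  have e : L.map (K.quotMap K' f) = L.map (cokernel.map K.ι (pushout.inr K.ι f) f
      (pushout.inl K.ι f) pushout.condition) ≫ L.map (P.quotMap K' (𝟙 A')) := by
    rw [← L.map_comp, K.map_quotMap_eq L K' f (pushout.inl K.ι f ≫ P.map K' (𝟙 A')) (by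
      have := P.ι_map K' (𝟙 A')
      rw [Category.id_comp] at this
      rw [pushout.condition_assoc, ← this])]
    congr 1
    rw [← cancel_epi (cokernel.π K.ι)]
    simp [quotMap, P]
  rw [e]
  infer_instance

/-- The functor sending a cofibrant object `A` to the quotient of its chosen cone by `A`. -/
noncomputable def cofibrantSuspension : CofibrantObject C ⥤ H where
  obj A := L.obj (stdCone A.obj).quot
  map {A A'} f := L.map ((stdCone A.obj).quotMap (stdCone A'.obj) f.hom)
  map_id _ := ConeOn.map_quotMap_id L _
  map_comp f g := ConeOn.map_quotMap_comp L _ _ _ f.hom g.hom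

lemma cofibrantSuspension_inverts :
    (weakEquivalences (CofibrantObject C)).IsInvertedBy (cofibrantSuspension L) := by
  have h {A A' : CofibrantObject C} (f : A ⟶ A') (_ : Cofibration f.hom)
      (_ : WeakEquivalence f.hom) : IsIso ((cofibrantSuspension L).map f) :=
    ConeOn.isIso_map_quotMap_of_trivialCofibration L _ _ _
  intro A A' f hf
  have hf' : WeakEquivalence f.hom := (weakEquivalence_iff _).2 hf
  obtain ⟨b⟩ := (inferInstance : Nonempty (CofibrantBrownFactorization f.hom))
  have : Cofibration b.i := (cofibration_iff _).2 b.hi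
  have : IsCofibrant b.Z := isCofibrant_of_cofibration b.i
  let i : A ⟶ CofibrantObject.mk b.Z := ObjectProperty.homMk b.i
  let p : CofibrantObject.mk b.Z ⟶ A' := ObjectProperty.homMk b.p
  let s : A' ⟶ CofibrantObject.mk b.Z := ObjectProperty.homMk b.s
  have hi : IsIso ((cofibrantSuspension L).map i) := h i ‹_› (inferInstanceAs (WeakEquivalence b.i))
  have hs : IsIso ((cofibrantSuspension L).map s) :=
    h s (inferInstanceAs (Cofibration b.s)) (inferInstanceAs (WeakEquivalence b.s))
  have hsp : (cofibrantSuspension L).map s ≫ (cofibrantSuspension L).map p = 𝟙 _ := by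
    rw [← Functor.map_comp, ← (cofibrantSuspension L).map_id]
    congr 1
    ext
    exact b.s_p
  have hp : IsIso ((cofibrantSuspension L).map p) := IsIso.of_isIso_fac_left hsp
  have hip : i ≫ p = f := by
    ext
    exact b.fac
  rw [← hip, Functor.map_comp]
  infer_instance

/-- The suspension functor on the homotopy category: it sends the class of a cofibrant object `A`
to the class of `K / A`, where `K` is any cone on `A` (see `suspensionIso`). -/
noncomputable def suspension : H ⥤ H :=
  Localization.lift (cofibrantSuspension L) (cofibrantSuspension_inverts L)
    (CofibrantObject.ι ⋙ L)

/-- The suspension of a cofibrant object `A` in terms of the chosen cone on `A`. -/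
noncomputable def suspensionStdIso (A : C) [IsCofibrant A] :
    L.obj (stdCone A).quot ≅ (suspension L).obj (L.obj A) :=
  (Localization.fac (cofibrantSuspension L) (cofibrantSuspension_inverts L)
    (CofibrantObject.ι ⋙ L)).symm.app (CofibrantObject.mk A)

lemma suspensionStdIso_naturality {A A' : C} [IsCofibrant A] [IsCofibrant A'] (f : A ⟶ A') :
    L.map ((stdCone A).quotMap (stdCone A') f) ≫ (suspensionStdIso L A').hom =
      (suspensionStdIso L A).hom ≫ (suspension L).map (L.map f) :=
  (Localization.fac (cofibrantSuspension L) (cofibrantSuspension_inverts L)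
    (CofibrantObject.ι ⋙ L)).inv.naturality (CofibrantObject.homMk f)

/-- For every cone `K` on a cofibrant object `A`, the quotient `K / A` represents the suspension
of `A`. -/
noncomputable def suspensionIso {A : C} [IsCofibrant A] (K : ConeOn A) :
    L.obj K.quot ≅ (suspension L).obj (L.obj A) :=
  asIso (L.map (K.quotMap (stdCone A) (𝟙 A))) ≪≫ suspensionStdIso L A

/-- The isomorphisms `suspensionIso` are natural with respect to all maps of cones. -/
lemma suspensionIso_naturality {A A' : C} [IsCofibrant A] [IsCofibrant A'] (K : ConeOn A)
    (K' : ConeOn A') (f : A ⟶ A') (g : K.obj ⟶ K'.obj) (w : K.ι ≫ g = f ≫ K'.ι) :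
    L.map (cokernel.map K.ι K'.ι f g w) ≫ (suspensionIso L K').hom =
      (suspensionIso L K).hom ≫ (suspension L).map (L.map f) := by
  have h₁ : L.map (cokernel.map K.ι K'.ι f g w) ≫ L.map (K'.quotMap (stdCone A') (𝟙 A')) =
      L.map (K.quotMap (stdCone A') f) := by
    rw [← L.map_comp, K.map_quotMap_eq L (stdCone A') f (g ≫ K'.map (stdCone A') (𝟙 A')) (by
      rw [reassoc_of% w, K'.ι_map, Category.id_comp])]
    congr 1
    rw [← cancel_epi (cokernel.π K.ι)]
    simp [ConeOn.quotMap]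
  have h₂ := K.map_quotMap_comp L (stdCone A) (stdCone A') (𝟙 A) f
  rw [Category.id_comp] at h₂
  simp only [suspensionIso, Iso.trans_hom, asIso_hom, Category.assoc]
  rw [reassoc_of% h₁, h₂, Category.assoc, suspensionStdIso_naturality]

end Suspension

section CofiberTriangles

variable {C : Type*} [Category* C] [ModelCategory C] [HasZeroMorphisms C] [HasZeroObject C]

/-- The map `B ∪_A K ⟶ B / A` collapsing a cone `K` on `A` attached to `B` along `i : A ⟶ B`. -/
noncomputable def collapseCone {A B : C} (i : A ⟶ B) (K : ConeOn A) :
    pushout i K.ι ⟶ cokernel i :=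
  pushout.desc (cokernel.π i) 0 (by simp)

/-- The map `B ∪_A K ⟶ K / A` collapsing `B`. -/
noncomputable def collapseBase {A B : C} (i : A ⟶ B) (K : ConeOn A) :
    pushout i K.ι ⟶ K.quot :=
  pushout.desc 0 (cokernel.π K.ι) (by simp)

variable {H : Type*} [Category* H] (L : C ⥤ H) [L.IsLocalization (weakEquivalences C)]

/-- `X ⟶ Y ⟶ Z ⟶ ΣX` is a cofiber triangle in the homotopy category if it is isomorphic to the
triangle `A ⟶ B ⟶ B / A ⟶ ΣA` of some cofibration `i : A ⟶ B` with `A` cofibrant. The last map of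
the latter is the composition of the inverse of `B ∪_A K ⟶ B / A`, which is a weak equivalence,
with `B ∪_A K ⟶ K / A` and `K / A ≅ ΣA`, for a cone `K` on `A`. -/
def IsCofiberTriangle {X Y Z : H} (u : X ⟶ Y) (v : Y ⟶ Z) (w : Z ⟶ (suspension L).obj X) : Prop :=
  ∃ (A B : C) (_ : IsCofibrant A) (i : A ⟶ B) (_ : Cofibration i) (K : ConeOn A)
    (eX : L.obj A ≅ X) (eY : L.obj B ≅ Y) (eZ : L.obj (cokernel i) ≅ Z),
    L.map i ≫ eY.hom = eX.hom ≫ u ∧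
    L.map (cokernel.π i) ≫ eZ.hom = eY.hom ≫ v ∧
    L.map (collapseCone i K) ≫ eZ.hom ≫ w =
      L.map (collapseBase i K) ≫ (suspensionIso L K).hom ≫ (suspension L).map eX.hom

/-- The iterated suspension `Σ^k`. -/
noncomputable def iteratedSuspension : ℕ → (H ⥤ H)
  | 0 => 𝟭 H
  | k + 1 => iteratedSuspension k ⋙ suspension L

end CofiberTriangles

section Complexes

variable {H : Type*} [Category* H] [Preadditive H] [HasZeroObject H]

/-- The objects of `Gr^l_n K`: they are those of `K` in the degrees `k` with `n - l < k ≤ n`. -/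
noncomputable def grX (l n : ℕ) (K : ChainComplex H ℕ) (k : ℕ) : H :=
  if k ≤ n ∧ n < k + l then K.X k else 0

/-- The identification of `Gr^l_n K` with `K` in the degrees `k` with `n - l < k ≤ n`. -/
noncomputable def grXIso {l n : ℕ} (K : ChainComplex H ℕ) {k : ℕ} (h : k ≤ n ∧ n < k + l) :
    grX l n K k ≅ K.X k :=
  eqToIso (if_pos h)

lemma isZero_grX {l n : ℕ} (K : ChainComplex H ℕ) {k : ℕ} (h : ¬ (k ≤ n ∧ n < k + l)) :
    IsZero (grX l n K k) := by
  rw [grX, if_neg h]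
  exact isZero_zero H

/-- The differential of `Gr^l_n K`. -/
noncomputable def grD (l n : ℕ) (K : ChainComplex H ℕ) (i j : ℕ) : grX l n K i ⟶ grX l n K j :=
  if h : (i ≤ n ∧ n < i + l) ∧ (j ≤ n ∧ n < j + l) then
    (grXIso K h.1).hom ≫ K.d i j ≫ (grXIso K h.2).inv else 0

/-- The subquotient `Gr^l_n K = F_n K / F_{n-l} K` of the skeletal filtration of a chain complex
`K`, where `F_n K` is the part of `K` in degrees `≤ n` (so that `F_m K = 0` for `m < 0`). It is the
part of `K` in the degrees `k` with `n - l < k ≤ n`. -/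
noncomputable def gr (l n : ℕ) (K : ChainComplex H ℕ) : ChainComplex H ℕ where
  X := grX l n K
  d := grD l n K
  shape i j hij := by
    rw [grD]
    split_ifs with h
    · rw [K.shape i j hij, zero_comp, comp_zero]
    · rfl
  d_comp_d' i j k _ _ := by
    rw [grD, grD]
    split_ifs <;> simp

/-- The components of the map induced on `Gr^l_n` by a map of chain complexes. -/
noncomputable def grMapF (l n : ℕ) {K K' : ChainComplex H ℕ} (φ : K ⟶ K') (k : ℕ) :
    grX l n K k ⟶ grX l n K' k :=
  if h : k ≤ n ∧ n < k + l then (grXIso K h).hom ≫ φ.f k ≫ (grXIso K' h).inv else 0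

/-- The map induced on `Gr^l_n` by a map of chain complexes. -/
noncomputable def grMap (l n : ℕ) {K K' : ChainComplex H ℕ} (φ : K ⟶ K') :
    gr l n K ⟶ gr l n K' where
  f := grMapF l n φ
  comm' i j _ := by
    change grMapF l n φ i ≫ grD l n K' i j = grD l n K i j ≫ grMapF l n φ j
    by_cases hi : i ≤ n ∧ n < i + l <;> by_cases hj : j ≤ n ∧ n < j + l <;>
      simp [grMapF, grD, hi, hj]

end Complexes

section Totalization

variable {C : Type*} [Category* C] [ModelCategory C] [HasZeroMorphisms C] [HasZeroObject C]
  {H : Type*} [Category* H] [Preadditive H]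
  (L : C ⥤ H) [L.IsLocalization (weakEquivalences C)]

/-- A totalization of a chain complex `K` in the homotopy category: a sequence of objects
`T 0 ⟶ T 1 ⟶ ⋯` (`T k` being a total object of `K_k ⟶ ⋯ ⟶ K_0`) which starts with `T 0 ≅ K_0`, and
such that `T (k + 1)` is the cofiber of a map `Σ^k K_{k+1} ⟶ T k` which lifts
`Σ^k d : Σ^k K_{k+1} ⟶ Σ^k K_k`. In particular the subquotients of this filtration are the
`Σ^k K_k`. -/
structure Totalization (K : ChainComplex H ℕ) where
  /-- the filtration -/
  T : ℕ → H
  /-- the transition maps of the filtration -/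
  incl (k : ℕ) : T k ⟶ T (k + 1)
  /-- the projection to the `k`-th subquotient -/
  proj (k : ℕ) : T k ⟶ (iteratedSuspension L k).obj (K.X k)
  /-- the attaching maps -/
  att (k : ℕ) : (iteratedSuspension L k).obj (K.X (k + 1)) ⟶ T k
  isIso_proj_zero : IsIso (proj 0)
  att_proj (k : ℕ) : att k ≫ proj k = (iteratedSuspension L k).map (K.d (k + 1) k)
  isCofiberTriangle (k : ℕ) : IsCofiberTriangle L (att k) (incl k) (proj (k + 1))

variable {L}

/-- A filtration-preserving map between totalizations of chain complexes `K` and `K'`, which is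
given by a chain map `φ` on the subquotients: each step of the filtration is mapped by the map
induced on the cofibers by the commutative square of attaching maps. -/
structure FilteredMap {K K' : ChainComplex H ℕ} (S : Totalization L K) (T : Totalization L K')
    (φ : K ⟶ K') where
  /-- the map on the `k`-th step of the filtration -/
  app (k : ℕ) : S.T k ⟶ T.T k
  incl_app (k : ℕ) : S.incl k ≫ app (k + 1) = app k ≫ T.incl k
  proj_map (k : ℕ) : S.proj k ≫ (iteratedSuspension L k).map (φ.f k) = app k ≫ T.proj k
  att_app (k : ℕ) : S.att k ≫ app k = (iteratedSuspension L k).map (φ.f (k + 1)) ≫ T.att k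

variable [HasZeroObject H]

/-- The underlying object `Tot (Gr^l_n K)` of a totalization of `Gr^l_n K`: it is the `n`-th step of
the filtration, as `Gr^l_n K` vanishes in degrees `> n`. -/
def Totalization.tot {l n : ℕ} {K : ChainComplex H ℕ} (S : Totalization L (gr l n K)) : H :=
  S.T n

/-- The underlying map `Tot (Gr^l_n K) ⟶ Tot (Gr^l_n K')` of a filtration-preserving map. -/
def FilteredMap.tot {l n : ℕ} {K K' : ChainComplex H ℕ} {S : Totalization L (gr l n K)}
    {T : Totalization L (gr l n K')} {φ : gr l n K ⟶ gr l n K'} (h : FilteredMap S T φ) :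
    S.tot ⟶ T.tot :=
  h.app n

end Totalization

end StableTot

open AlgebraicTopology StableTot

/-! The maps `h_k` are built by recursion on `k`, each induced on cofibers by the square of
attaching maps. The obstruction is commutativity of that square: compatibility of `h_k` with `p_k`
gives it only after composition with `p_k`. For a complex with two adjacent nonzero terms, in
degrees `n - 1` and `n`, the obstruction vanishes. If `k < n`, then `T_{k-1}` is zero (for `k ≥ 1`),
so `p_k` is an isomorphism and can be cancelled; if `k ≥ n`, the source `Σ^k K_{k+1}` is zero.

The fill-in on cofibers (`IsCofiberTriangle.exists_map`) is proved in the model category. A square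
commuting in the homotopy category is rectified by homotopy extension, and the strict map induced on
quotients is compatible with the connecting maps. It is an isomorphism if the square consists of
isomorphisms, since maps inverted by `L` between suitable objects are weak equivalences and the
gluing lemma applies. -/

namespace StableTot

/-! ### Weak equivalences and squares lifted from the homotopy category -/

section Rectification

variable {C : Type*} [Category* C] [ModelCategory C]
    {H : Type*} [Category* H] (L : C ⥤ H) [L.IsLocalization (weakEquivalences C)]

/-- A fibration between bifibrant objects which becomes an isomorphism in the homotopy category is
a weak equivalence. -/
lemma weakEquivalence_of_fibration_of_isIso_map {X Y : C} [IsCofibrant X] [IsFibrant X]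
    [IsCofibrant Y] [IsFibrant Y] (p : X ⟶ Y) [Fibration p] [IsIso (L.map p)] :
    WeakEquivalence p := by
  obtain ⟨s₀, hs₀⟩ := map_surjective_of_isLocalization L Y X (inv (L.map p))
  have hr : LeftHomotopyRel (s₀ ≫ p) (𝟙 Y) := by
    rw [LeftHomotopyRel.iff_map_eq L, L.map_comp, hs₀, IsIso.inv_hom_id, L.map_id]
  obtain ⟨P, _, ⟨h⟩⟩ := hr.exists_good_cylinder
  -- Lifting the homotopy through `p`, starting at `s₀`, turns the homotopy section `s₀` into a
  -- strict section `s`.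
  have sq : CommSq s₀ P.i₀ p h.h := ⟨h.h₀.symm⟩
  let s : Y ⟶ X := P.i₁ ≫ sq.lift
  have hs : s ≫ p = 𝟙 Y := by simp [s, h.h₁]
  have hLs : L.map s = inv (L.map p) := by
    rw [← cancel_mono (L.map p), ← L.map_comp, hs, IsIso.inv_hom_id, L.map_id]
  have h₁ : RightHomotopyRel (p ≫ s) (𝟙 X) := by
    rw [RightHomotopyRel.iff_map_eq L, L.map_comp, hLs, IsIso.hom_inv_id, L.map_id]
  obtain ⟨Q, ⟨h₂⟩⟩ := h₁
  have h₃ : WeakEquivalence (p ≫ s) := h₂.weakEquivalence_iff.2 inferInstance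
  -- The strict section makes `p` a retract of `p ≫ s`, a weak equivalence because it is homotopic
  -- to the identity.
  let r : RetractArrow p (p ≫ s) :=
    { i := Arrow.homMk (𝟙 X) s (by simp)
      r := Arrow.homMk (𝟙 X) p (by simp [hs])
      retract := by ext <;> simp [hs] }
  rw [weakEquivalence_iff] at h₃ ⊢
  exact (weakEquivalences C).of_retract r h₃

/-- A map from a cofibrant object to a bifibrant object which becomes an isomorphism in the homotopy
category is a weak equivalence. -/
lemma weakEquivalence_of_isIso_map {X Y : C} [IsCofibrant X] [IsCofibrant Y] [IsFibrant Y]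
    (f : X ⟶ Y) [IsIso (L.map f)] : WeakEquivalence f := by
  have fac := MorphismProperty.factorizationData (trivialCofibrations C) (fibrations C) f
  obtain ⟨_, _⟩ := (mem_trivialCofibrations_iff _).1 fac.hi
  have : Fibration fac.p := (fibration_iff _).2 fac.hp
  have := isCofibrant_of_cofibration fac.i
  have := isFibrant_of_fibration fac.p
  have : IsIso (L.map fac.i) := isIso_map_of_weakEquivalence L _
  have e : L.map fac.i ≫ L.map fac.p = L.map f := by rw [← L.map_comp, fac.fac]
  have : IsIso (L.map fac.p) := IsIso.of_isIso_fac_left e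
  have := weakEquivalence_of_fibration_of_isIso_map L fac.p
  rw [← fac.fac]
  infer_instance

/-- A cofibration with cofibrant source is weakly equivalent to a cofibration between bifibrant
objects. -/
lemma exists_bifibrant_cofibration {A B : C} [IsCofibrant A] (i : A ⟶ B) [Cofibration i] :
    ∃ (A' B' : C) (_ : IsCofibrant A') (_ : IsFibrant A') (_ : IsFibrant B') (i' : A' ⟶ B')
      (_ : Cofibration i') (a : A ⟶ A') (b : B ⟶ B') (_ : WeakEquivalence a)
      (_ : WeakEquivalence b), i ≫ b = a ≫ i' := by
  -- Both resolutions are trivial cofibrations: pushing out along `a` changes `B` only up to weak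
  -- equivalence, and the second resolution keeps the map out of `A'` a cofibration.
  let a := FibrantObject.HoCat.iResolutionObj A
  let b := FibrantObject.HoCat.iResolutionObj (pushout i a)
  refine ⟨_, _, inferInstance, inferInstance, inferInstance, pushout.inr i a ≫ b, inferInstance,
    a, pushout.inl i a ≫ b, inferInstance, inferInstance, ?_⟩
  rw [pushout.condition_assoc]

/-- A square in the homotopy category between cofibrations can be rectified to a strictly
commutative square, if the target objects are fibrant. -/
lemma exists_strict_square {A B A' B' : C} [IsCofibrant A] [IsFibrant A'] [IsFibrant B']
    (i : A ⟶ B) (i' : A' ⟶ B') [Cofibration i] (α : L.obj A ⟶ L.obj A')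
    (β : L.obj B ⟶ L.obj B') (w : L.map i ≫ β = α ≫ L.map i') :
    ∃ (f : A ⟶ A') (g : B ⟶ B'), i ≫ g = f ≫ i' ∧ L.map f = α ∧ L.map g = β := by
  have := isCofibrant_of_cofibration i
  obtain ⟨f, rfl⟩ := map_surjective_of_isLocalization L A A' α
  obtain ⟨g, rfl⟩ := map_surjective_of_isLocalization L B B' β
  rw [← L.map_comp, ← L.map_comp, ← RightHomotopyRel.iff_map_eq L] at w
  -- The homotopy from `i ≫ g` to `f ≫ i'` extends over `B`; its other end `g'` restricts strictly
  -- to `f ≫ i'`.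
  obtain ⟨P, _, ⟨h⟩⟩ := w.exists_good_pathObject
  obtain ⟨g', h', hh⟩ := h.homotopy_extension i g
  refine ⟨f, g', ?_, rfl, ((RightHomotopyRel.iff_map_eq L _ _).1 h'.rightHomotopyRel).symm⟩
  rw [← h'.h₁, reassoc_of% hh, h.h₁]

instance isCofibrant_zero [HasZeroObject C] : IsCofibrant (0 : C) :=
  (isCofibrant_iff_of_isInitial (𝟙 (0 : C)) (isZero_zero C).isInitial).2 inferInstance

instance isFibrant_zero [HasZeroObject C] : IsFibrant (0 : C) :=
  (isFibrant_iff_of_isTerminal (𝟙 (0 : C)) (isZero_zero C).isTerminal).2 inferInstance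

/-- Since `0` is bifibrant, the zero endomorphism of `L.obj 0` lifts to an endomorphism of `0`,
which can only be the identity. -/
lemma isZero_map_zero [HasZeroObject C] [HasZeroMorphisms H] : IsZero (L.obj 0) := by
  rw [IsZero.iff_id_eq_zero]
  obtain ⟨f, hf⟩ := map_surjective_of_isLocalization L (0 : C) 0 0
  rw [← hf, ← L.map_id]
  congr 1
  exact (isZero_zero C).eq_of_src _ _

end Rectification

/-! ### The gluing lemma for quotients by cofibrations -/

section Gluing

variable {C : Type*} [Category* C] [ModelCategory C] [HasZeroMorphisms C]

/-- The gluing lemma for quotients, along a trivial cofibration of the subobjects. -/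
lemma weakEquivalence_cokernelMap_of_trivialCofibration_left {A B A' B' : C}
    (i : A ⟶ B) (i' : A' ⟶ B') [Cofibration i] [Cofibration i'] (f : A ⟶ A') (g : B ⟶ B')
    (w : i ≫ g = f ≫ i') [Cofibration f] [WeakEquivalence f] [WeakEquivalence g] :
    WeakEquivalence (cokernel.map i i' f g w) := by
  -- The pushout along `f` splits the map of pairs into one inducing an isomorphism on quotients and
  -- one fixing the subobject `A'`.
  have h : pushout.inl i f ≫ pushout.desc g i' w = g := pushout.inl_desc _ _ _
  have h' : pushout.inr i f ≫ pushout.desc g i' w = i' := pushout.inr_desc _ _ _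
  have : WeakEquivalence (pushout.desc g i' w) := weakEquivalence_of_precomp_of_fac h
  have h₁ := weakEquivalence_cokernelMap_under (pushout.inr i f) i' (pushout.desc g i' w) h'
  have : IsIso (cokernel.map i (pushout.inr i f) f (pushout.inl i f) pushout.condition) :=
    isIso_cokernel_map_of_isPushout (IsPushout.of_hasPushout i f)
  have e : cokernel.map i (pushout.inr i f) f (pushout.inl i f) pushout.condition ≫
      cokernel.map (pushout.inr i f) i' (𝟙 A') (pushout.desc g i' w) (by simp [h']) =
      cokernel.map i i' f g w := by
    rw [← cancel_epi (cokernel.π i)]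
    simp [reassoc_of% h]
  rw [← e]
  infer_instance

/-- The gluing lemma for quotients of cofibrant objects. -/
lemma weakEquivalence_cokernelMap {A B A' B' : C} [IsCofibrant A] [IsCofibrant A']
    (i : A ⟶ B) (i' : A' ⟶ B') [Cofibration i] [Cofibration i'] (f : A ⟶ A') (g : B ⟶ B')
    (w : i ≫ g = f ≫ i') [WeakEquivalence f] [WeakEquivalence g] :
    WeakEquivalence (cokernel.map i i' f g w) := by
  -- Ken Brown's argument: `b.i` and the section `b.s` of `b.p` are trivial cofibrations. A pair `k
  -- : b.Z ⟶ fac.Z` is built that receives `i` along `b.i` and `i'` along `b.s`, so that the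
  -- previous case applies to both.
  let b : CofibrantBrownFactorization f := Classical.arbitrary _
  have : Cofibration b.i := (cofibration_iff _).2 b.hi
  let q : pushout i b.i ⟶ B' := pushout.desc g (b.p ≫ i') (by rw [w, b.fac_assoc])
  have hq₁ : pushout.inl i b.i ≫ q = g := pushout.inl_desc _ _ _
  have hq₂ : pushout.inr i b.i ≫ q = b.p ≫ i' := pushout.inr_desc _ _ _
  let t : A' ⟶ pushout i b.i := b.s ≫ pushout.inr i b.i
  have ht : t ≫ q = i' ≫ 𝟙 B' := by simp [t, hq₂]
  let q' : pushout t i' ⟶ B' := pushout.desc q (𝟙 B') ht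
  have hq'₁ : pushout.inl t i' ≫ q' = q := pushout.inl_desc _ _ _
  have hq'₂ : pushout.inr t i' ≫ q' = 𝟙 B' := pushout.inr_desc _ _ _
  have fac := MorphismProperty.factorizationData (cofibrations C) (trivialFibrations C) q'
  have : Cofibration fac.i := (cofibration_iff _).2 fac.hi
  have : WeakEquivalence fac.p := ((mem_trivialFibrations_iff _).1 fac.hp).2
  let k : b.Z ⟶ fac.Z := pushout.inr i b.i ≫ pushout.inl t i' ≫ fac.i
  let x : B ⟶ fac.Z := pushout.inl i b.i ≫ pushout.inl t i' ≫ fac.i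
  let y : B' ⟶ fac.Z := pushout.inr t i' ≫ fac.i
  have hk : k ≫ fac.p = b.p ≫ i' := by simp [k, hq'₁, hq₂]
  have hx : x ≫ fac.p = g := by simp [x, hq'₁, hq₁]
  have hy : y ≫ fac.p = 𝟙 B' := by simp [y, hq'₂]
  have : WeakEquivalence x := weakEquivalence_of_postcomp_of_fac hx
  have : WeakEquivalence y := weakEquivalence_of_postcomp_of_fac hy
  have wx : i ≫ x = b.i ≫ k := by simp [x, k, pushout.condition_assoc]
  have wy : i' ≫ y = b.s ≫ k := by
    simp only [y, k, ← pushout.condition_assoc]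
    simp [t]
  have h₁ := weakEquivalence_cokernelMap_of_trivialCofibration_left i k b.i x wx
  have h₂ := weakEquivalence_cokernelMap_of_trivialCofibration_left i' k b.s y wy
  -- The retraction onto `i'` splits a weak equivalence on quotients, hence is one by
  -- two-out-of-three.
  have h₃ : cokernel.map i' k b.s y wy ≫ cokernel.map k i' b.p fac.p hk = 𝟙 _ := by
    rw [← cancel_epi (cokernel.π i')]
    simp [reassoc_of% hy]
  have h₄ : WeakEquivalence (cokernel.map k i' b.p fac.p hk) :=
    weakEquivalence_of_precomp_of_fac h₃
  have h₅ : cokernel.map i k b.i x wx ≫ cokernel.map k i' b.p fac.p hk =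
      cokernel.map i i' f g w := by
    rw [← cancel_epi (cokernel.π i)]
    simp [reassoc_of% hx]
  rw [← h₅]
  infer_instance

variable [HasZeroObject C]

/-- Collapsing a contractible cofibrant subobject is a weak equivalence. -/
lemma weakEquivalence_cokernelπ {A B : C} [IsCofibrant A] (i : A ⟶ B) [Cofibration i]
    [WeakEquivalence (0 : A ⟶ 0)] : WeakEquivalence (cokernel.π i) := by
  have hA (X : C) [IsCofibrant X] : Cofibration (0 : (0 : C) ⟶ X) :=
    (isCofibrant_iff_of_isInitial _ (isZero_zero C).isInitial).1 inferInstance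
  have := isCofibrant_of_cofibration i
  have := hA A
  have := hA B
  have : WeakEquivalence (0 : 0 ⟶ A) :=
    weakEquivalence_of_postcomp_of_fac
      (show (0 : 0 ⟶ A) ≫ (0 : A ⟶ 0) = 𝟙 0 from (isZero_zero C).eq_of_src _ _)
  -- As `A` is contractible, the gluing lemma compares `B / 0` with `B / A`.
  have h := weakEquivalence_cokernelMap (0 : (0 : C) ⟶ B) i 0 (𝟙 B) (by simp)
  have e : cokernel.π (0 : (0 : C) ⟶ B) ≫ cokernel.map (0 : (0 : C) ⟶ B) i 0 (𝟙 B) (by simp) =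
      cokernel.π i := by simp
  rw [← e]
  infer_instance

end Gluing

/-! ### Connecting maps and their naturality -/

section Connecting

variable {C : Type*} [Category* C] [ModelCategory C] [HasZeroMorphisms C] [HasZeroObject C]

/-- Under `B / A ≅ (B ∪_A K) / K`, this is the collapse of the contractible subobject `K`. -/
instance weakEquivalence_collapseCone {A B : C} [IsCofibrant A] (i : A ⟶ B) [Cofibration i]
    (K : ConeOn A) : WeakEquivalence (collapseCone i K) := by
  have := isCofibrant_of_cofibration K.ι
  have : IsIso (cokernel.map i (pushout.inr i K.ι) K.ι (pushout.inl i K.ι) pushout.condition) :=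
    isIso_cokernel_map_of_isPushout (IsPushout.of_hasPushout i K.ι)
  have := weakEquivalence_cokernelπ (pushout.inr i K.ι)
  have e : collapseCone i K ≫
      cokernel.map i (pushout.inr i K.ι) K.ι (pushout.inl i K.ι) pushout.condition =
      cokernel.π (pushout.inr i K.ι) := by
    apply pushout.hom_ext
    · rw [collapseCone, pushout.inl_desc_assoc]
      simp
    · rw [collapseCone, pushout.inr_desc_assoc]
      simp
  exact weakEquivalence_of_postcomp_of_fac e

/-- Symmetrically, `K / A ≅ (B ∪_A K) / B`, and here `B` is contractible. -/
lemma weakEquivalence_collapseBase {A B : C} [IsCofibrant A] (i : A ⟶ B) [Cofibration i]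
    [WeakEquivalence (0 : B ⟶ 0)] (K : ConeOn A) : WeakEquivalence (collapseBase i K) := by
  have := isCofibrant_of_cofibration i
  have : IsIso (cokernel.map K.ι (pushout.inl i K.ι) i (pushout.inr i K.ι)
      pushout.condition.symm) :=
    isIso_cokernel_map_of_isPushout (IsPushout.of_hasPushout i K.ι).flip
  have := weakEquivalence_cokernelπ (pushout.inl i K.ι)
  have e : collapseBase i K ≫
      cokernel.map K.ι (pushout.inl i K.ι) i (pushout.inr i K.ι) pushout.condition.symm =
      cokernel.π (pushout.inl i K.ι) := by
    apply pushout.hom_ext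
    · rw [collapseBase, pushout.inl_desc_assoc]
      simp
    · rw [collapseBase, pushout.inr_desc_assoc]
      simp
  exact weakEquivalence_of_postcomp_of_fac e

variable {H : Type*} [Category* H] (L : C ⥤ H) [L.IsLocalization (weakEquivalences C)]

instance isIso_map_collapseCone {A B : C} [IsCofibrant A] (i : A ⟶ B) [Cofibration i]
    (K : ConeOn A) : IsIso (L.map (collapseCone i K)) :=
  isIso_map_of_weakEquivalence L _

/-- The connecting map `B / A ⟶ ΣA` of a cofibration, computed with a cone `K` on `A`. -/
noncomputable def connecting {A B : C} [IsCofibrant A] (i : A ⟶ B) [Cofibration i]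
    (K : ConeOn A) : L.obj (cokernel i) ⟶ (suspension L).obj (L.obj A) :=
  inv (L.map (collapseCone i K)) ≫ L.map (collapseBase i K) ≫ (suspensionIso L K).hom

lemma map_collapseCone_comp_connecting {A B : C} [IsCofibrant A] (i : A ⟶ B) [Cofibration i]
    (K : ConeOn A) : L.map (collapseCone i K) ≫ connecting L i K =
      L.map (collapseBase i K) ≫ (suspensionIso L K).hom := by
  simp [connecting]

/-- The map of pairs and the map of cones glue to a map `m` of mapping cones, which commutes with
both collapses. -/
lemma connecting_naturality_of_coneMap {A B A' B' : C} [IsCofibrant A] [IsCofibrant A']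
    (i : A ⟶ B) (i' : A' ⟶ B') [Cofibration i] [Cofibration i'] (f : A ⟶ A') (g : B ⟶ B')
    (w : i ≫ g = f ≫ i') (K : ConeOn A) (K' : ConeOn A') (r : K.obj ⟶ K'.obj)
    (hr : K.ι ≫ r = f ≫ K'.ι) :
    connecting L i K ≫ (suspension L).map (L.map f) =
      L.map (cokernel.map i i' f g w) ≫ connecting L i' K' := by
  let m : pushout i K.ι ⟶ pushout i' K'.ι :=
    pushout.desc (g ≫ pushout.inl _ _) (r ≫ pushout.inr _ _)
      (by rw [reassoc_of% w, reassoc_of% hr, pushout.condition])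
  have hm₁ : pushout.inl i K.ι ≫ m = g ≫ pushout.inl _ _ := pushout.inl_desc _ _ _
  have hm₂ : pushout.inr i K.ι ≫ m = r ≫ pushout.inr _ _ := pushout.inr_desc _ _ _
  have h₁ : m ≫ collapseCone i' K' = collapseCone i K ≫ cokernel.map i i' f g w := by
    apply pushout.hom_ext
    · rw [reassoc_of% hm₁, collapseCone, pushout.inl_desc, collapseCone, pushout.inl_desc_assoc]
      simp
    · rw [reassoc_of% hm₂, collapseCone, pushout.inr_desc, collapseCone, pushout.inr_desc_assoc]
      simp
  have h₂ : m ≫ collapseBase i' K' = collapseBase i K ≫ cokernel.map K.ι K'.ι f r hr := by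
    apply pushout.hom_ext
    · rw [reassoc_of% hm₁, collapseBase, pushout.inl_desc, collapseBase, pushout.inl_desc_assoc]
      simp
    · rw [reassoc_of% hm₂, collapseBase, pushout.inr_desc, collapseBase, pushout.inr_desc_assoc]
      simp
  rw [← cancel_epi (L.map (collapseCone i K)),
    reassoc_of% (map_collapseCone_comp_connecting L i K),
    ← suspensionIso_naturality L K K' f r hr, ← L.map_comp_assoc, ← h₂, ← L.map_comp_assoc, ← h₁,
    L.map_comp_assoc, L.map_comp_assoc, map_collapseCone_comp_connecting]

lemma connecting_eq {A B : C} [IsCofibrant A] (i : A ⟶ B) [Cofibration i] (K : ConeOn A)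
    (K' : FibrantConeOn A) : connecting L i K = connecting L i K'.toConeOn := by
  have h := connecting_naturality_of_coneMap L i i (𝟙 A) (𝟙 B) (by simp) K K'.toConeOn
    (K.map K' (𝟙 A)) (K.ι_map K' (𝟙 A))
  have e : cokernel.map i i (𝟙 A) (𝟙 B) (by simp) = 𝟙 _ := by
    rw [← cancel_epi (cokernel.π i)]
    simp
  simpa [e] using h

/-- Extending `f` to cones requires a fibrant target cone, so `K'` is first exchanged for the
standard one. -/
lemma connecting_naturality {A B A' B' : C} [IsCofibrant A] [IsCofibrant A']
    (i : A ⟶ B) (i' : A' ⟶ B') [Cofibration i] [Cofibration i'] (f : A ⟶ A') (g : B ⟶ B')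
    (w : i ≫ g = f ≫ i') (K : ConeOn A) (K' : ConeOn A') :
    connecting L i K ≫ (suspension L).map (L.map f) =
      L.map (cokernel.map i i' f g w) ≫ connecting L i' K' := by
  rw [connecting_eq L i' K' (stdCone A')]
  exact connecting_naturality_of_coneMap L i i' f g w K _ (K.map (stdCone A') f)
    (K.ι_map (stdCone A') f)

end Connecting

/-! ### Fill-in for cofiber triangles -/

section FillIn

variable {C : Type*} [Category* C] [ModelCategory C] [HasZeroMorphisms C] [HasZeroObject C]

variable {H : Type*} [Category* H] {L : C ⥤ H} [L.IsLocalization (weakEquivalences C)]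

/-- A commutative square between the first maps of two cofiber triangles extends to a map of
triangles, which can be chosen to be an isomorphism if the square consists of isomorphisms. -/
lemma IsCofiberTriangle.exists_map {X Y Z X' Y' Z' : H} {u : X ⟶ Y} {v : Y ⟶ Z}
    {w : Z ⟶ (suspension L).obj X} {u' : X' ⟶ Y'} {v' : Y' ⟶ Z'}
    {w' : Z' ⟶ (suspension L).obj X'} (h : IsCofiberTriangle L u v w)
    (h' : IsCofiberTriangle L u' v' w') (α : X ⟶ X') (β : Y ⟶ Y') (comm : u ≫ β = α ≫ u') :
    ∃ γ : Z ⟶ Z', v ≫ γ = β ≫ v' ∧ w ≫ (suspension L).map α = γ ≫ w' ∧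
      (IsIso α → IsIso β → IsIso γ) := by
  obtain ⟨A, B, _, i, _, K, eX, eY, eZ, hu, hv, hw⟩ := h
  obtain ⟨A', B', _, i', _, K', eX', eY', eZ', hu', hv', hw'⟩ := h'
  -- Rectification needs fibrant targets, so `i'` is replaced by `i''`. The resulting map of
  -- quotients is brought back by inverting `B' / A' ⟶ B'' / A''`.
  obtain ⟨A'', B'', _, _, _, i'', _, a, b, _, _, hab⟩ := exists_bifibrant_cofibration i'
  have : IsIso (L.map a) := isIso_map_of_weakEquivalence L a
  have : IsIso (L.map b) := isIso_map_of_weakEquivalence L b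
  have := isCofibrant_of_cofibration i
  have := isCofibrant_of_cofibration i''
  have := weakEquivalence_cokernelMap i' i'' a b hab
  have hc : IsIso (L.map (cokernel.map i' i'' a b hab)) := isIso_map_of_weakEquivalence L _
  obtain ⟨f, g, hfg, hf, hg⟩ := exists_strict_square L i i''
    (eX.hom ≫ α ≫ eX'.inv ≫ L.map a) (eY.hom ≫ β ≫ eY'.inv ≫ L.map b) (by
      have hu'' : u' ≫ eY'.inv = eX'.inv ≫ L.map i' := by
        rw [Iso.comp_inv_eq, Category.assoc, hu', Iso.inv_hom_id_assoc]
      rw [reassoc_of% hu, reassoc_of% comm, reassoc_of% hu'', ← L.map_comp, hab]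
      simp)
  have hw₀ : eZ.hom ≫ w = connecting L i K ≫ (suspension L).map eX.hom := by
    rw [← cancel_epi (L.map (collapseCone i K)), hw,
      reassoc_of% (map_collapseCone_comp_connecting L i K)]
  have hw₀' : eZ'.hom ≫ w' = connecting L i' K' ≫ (suspension L).map eX'.hom := by
    rw [← cancel_epi (L.map (collapseCone i' K')), hw',
      reassoc_of% (map_collapseCone_comp_connecting L i' K')]
  have n₁ := connecting_naturality L i i'' f g hfg K (stdCone A'').toConeOn
  have n₂ := connecting_naturality L i' i'' a b hab K' (stdCone A'').toConeOn
  refine ⟨eZ.inv ≫ L.map (cokernel.map i i'' f g hfg) ≫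
    inv (L.map (cokernel.map i' i'' a b hab)) ≫ eZ'.hom, ?_, ?_, ?_⟩
  · have e₁ : v ≫ eZ.inv = eY.inv ≫ L.map (cokernel.π i) := by
      rw [Iso.comp_inv_eq, Category.assoc, hv, Iso.inv_hom_id_assoc]
    have e₂ : L.map (cokernel.π i) ≫ L.map (cokernel.map i i'' f g hfg) =
        L.map g ≫ L.map (cokernel.π i'') := by
      rw [← L.map_comp, ← L.map_comp]
      simp
    have e₃ : L.map b ≫ L.map (cokernel.π i'') =
        L.map (cokernel.π i') ≫ L.map (cokernel.map i' i'' a b hab) := by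
      rw [← L.map_comp, ← L.map_comp]
      simp
    rw [reassoc_of% e₁, reassoc_of% e₂, hg]
    simp only [Category.assoc]
    rw [reassoc_of% e₃]
    simp [hv']
  · rw [← cancel_epi eZ.hom, reassoc_of% hw₀]
    simp only [Category.assoc, Iso.hom_inv_id_assoc]
    rw [hw₀', ← cancel_mono ((suspension L).map (eX'.inv ≫ L.map a))]
    have e : connecting L i' K' = L.map (cokernel.map i' i'' a b hab) ≫
        connecting L i'' (stdCone A'').toConeOn ≫ inv ((suspension L).map (L.map a)) := by
      rw [← reassoc_of% n₂]
      simp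
    rw [e]
    simp only [Category.assoc, IsIso.inv_hom_id_assoc]
    simp only [← Functor.map_comp]
    simp only [Iso.hom_inv_id_assoc, IsIso.inv_hom_id, Category.comp_id, ← hf, ← n₁]
  · intro _ _
    have : IsIso (L.map f) := by rw [hf]; infer_instance
    have : IsIso (L.map g) := by rw [hg]; infer_instance
    have : WeakEquivalence f := weakEquivalence_of_isIso_map L f
    have : WeakEquivalence g := weakEquivalence_of_isIso_map L g
    have := weakEquivalence_cokernelMap i i'' f g hfg
    have : IsIso (L.map (cokernel.map i i'' f g hfg)) := isIso_map_of_weakEquivalence L _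
    infer_instance

end FillIn

/-! ### Cofiber triangles with a zero term -/

section Zero

variable {C : Type*} [Category* C] [ModelCategory C] [HasZeroMorphisms C] [HasZeroObject C]
  {H : Type*} [Category* H] [HasZeroMorphisms H] {L : C ⥤ H}
  [L.IsLocalization (weakEquivalences C)]

variable (L) in
lemma weakEquivalence_zero_of_isZero_map {B : C} [IsCofibrant B] (h : IsZero (L.obj B)) :
    WeakEquivalence (0 : B ⟶ 0) := by
  have : IsIso (L.map (0 : B ⟶ 0)) :=
    ⟨0, h.eq_of_src _ _, (isZero_map_zero L).eq_of_src _ _⟩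
  exact weakEquivalence_of_isIso_map L _

/-- In a model of the triangle `B` is contractible, so `B ∪_A K` is weakly equivalent to both `B /
A` and `K / A` by its two collapses. -/
lemma IsCofiberTriangle.isIso_of_isZero {X Y Z : H} {u : X ⟶ Y} {v : Y ⟶ Z}
    {w : Z ⟶ (suspension L).obj X} (h : IsCofiberTriangle L u v w) (hY : IsZero Y) :
    IsIso w := by
  obtain ⟨A, B, _, i, _, K, eX, eY, eZ, hu, hv, hw⟩ := h
  have := isCofibrant_of_cofibration i
  have : WeakEquivalence (0 : B ⟶ 0) := weakEquivalence_zero_of_isZero_map L (hY.of_iso eY)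
  have := weakEquivalence_collapseBase i K
  have : IsIso (L.map (collapseBase i K)) := isIso_map_of_weakEquivalence L _
  rw [← Category.assoc] at hw
  have : IsIso ((L.map (collapseCone i K) ≫ eZ.hom) ≫ w) := by
    rw [hw]
    infer_instance
  exact IsIso.of_isIso_comp_left (L.map (collapseCone i K) ≫ eZ.hom) w

variable (L) in
lemma isZero_iteratedSuspension [(suspension L).IsEquivalence] (k : ℕ) {X : H} (hX : IsZero X) :
    IsZero ((iteratedSuspension L k).obj X) := by
  induction k with
  | zero => exact hX
  | succ k ih => exact (suspension L).map_isZero ih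

end Zero

/-! ### Filtered maps of totalizations -/

section Totalization

variable {C : Type*} [Category* C] [ModelCategory C] [HasZeroMorphisms C] [HasZeroObject C]
  {H : Type*} [Category* H] [Preadditive H] {L : C ⥤ H}
  [L.IsLocalization (weakEquivalences C)]

/-- A chain map extends to a filtered map of totalizations if the compatibility with the attaching
maps follows from the compatibility with the projections. -/
lemma FilteredMap.exists_of_mono_proj [(suspension L).IsEquivalence] {K K' : ChainComplex H ℕ}
    (S : Totalization L K) (T : Totalization L K') (φ : K ⟶ K')
    (hT : ∀ k, IsZero (K.X (k + 1)) ∨ Mono (T.proj k)) :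
    ∃ h : FilteredMap S T φ, (∀ k, IsIso (φ.f k)) → ∀ k, IsIso (h.app k) := by
  have att (k : ℕ) (a : S.T k ⟶ T.T k)
      (ha : S.proj k ≫ (iteratedSuspension L k).map (φ.f k) = a ≫ T.proj k) :
      S.att k ≫ a = (iteratedSuspension L k).map (φ.f (k + 1)) ≫ T.att k := by
    rcases hT k with h | h
    · exact (isZero_iteratedSuspension L k h).eq_of_src _ _
    · rw [← cancel_mono (T.proj k), Category.assoc, ← ha, ← Category.assoc, S.att_proj,
        Category.assoc, T.att_proj, ← Functor.map_comp, ← Functor.map_comp, φ.comm]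
  -- Compatibility with `proj` is all the recursion must carry: it implies that the next attaching
  -- square commutes, and the fill-in returns it one degree higher.
  let P (k : ℕ) : Type _ := { a : S.T k ⟶ T.T k //
    S.proj k ≫ (iteratedSuspension L k).map (φ.f k) = a ≫ T.proj k }
  have step (k : ℕ) (a : P k) : ∃ b : P (k + 1), S.incl k ≫ b.1 = a.1 ≫ T.incl k ∧
      (IsIso ((iteratedSuspension L k).map (φ.f (k + 1))) → IsIso a.1 → IsIso b.1) := by
    obtain ⟨γ, h₁, h₂, h₃⟩ := (S.isCofiberTriangle k).exists_map (T.isCofiberTriangle k)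
      ((iteratedSuspension L k).map (φ.f (k + 1))) a.1 (att k a.1 a.2)
    exact ⟨⟨γ, h₂⟩, h₁, h₃⟩
  choose next h₁ h₂ using step
  have := T.isIso_proj_zero
  have := S.isIso_proj_zero
  let a (k : ℕ) : P k := Nat.rec
    ⟨S.proj 0 ≫ (iteratedSuspension L 0).map (φ.f 0) ≫ inv (T.proj 0), by simp⟩ next k
  refine ⟨⟨fun k ↦ (a k).1, fun k ↦ h₁ k (a k), fun k ↦ (a k).2, fun k ↦ att k _ (a k).2⟩,
    fun hφ k ↦ ?_⟩
  change IsIso (a k).1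
  induction k with
  | zero =>
    change IsIso (S.proj 0 ≫ (iteratedSuspension L 0).map (φ.f 0) ≫ inv (T.proj 0))
    infer_instance
  | succ k ih => exact h₂ k (a k) inferInstance ih

variable [HasZeroObject H]

/-- In a totalization of a complex with only two nonzero objects, in degrees `n - 1` and `n`, the
projections are isomorphisms in degrees `< n`. -/
lemma Totalization.isIso_proj_of_lt [(suspension L).IsEquivalence] {n : ℕ} {K : ChainComplex H ℕ}
    (S : Totalization L (gr 2 n K)) (m : ℕ) (hm : m < n) : IsIso (S.proj m) := by
  induction m with
  | zero => exact S.isIso_proj_zero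
  | succ m ih =>
    have := ih (by lia)
    -- From `m + 1 < n`, degree `m` lies below `n - 1`; so `S.T m`, the middle term of the next
    -- triangle, is zero.
    have h : IsZero ((iteratedSuspension L m).obj ((gr 2 n K).X m)) :=
      isZero_iteratedSuspension L m (isZero_grX K (by lia))
    exact (S.isCofiberTriangle m).isIso_of_isZero (h.of_iso (asIso (S.proj m)))

lemma isIso_grMap_f (l n : ℕ) {K K' : ChainComplex H ℕ} (φ : K ⟶ K') (hφ : ∀ k, IsIso (φ.f k))
    (k : ℕ) : IsIso ((grMap l n φ).f k) := by
  change IsIso (grMapF l n φ k)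
  by_cases h : k ≤ n ∧ n < k + l
  · rw [grMapF, dif_pos h]
    infer_instance
  · exact ⟨0, (isZero_grX K h).eq_of_src _ _, (isZero_grX K' h).eq_of_src _ _⟩

end Totalization

end StableTot

open AlgebraicTopology StableTot
theorem mainTheorem6 {C : Type*} [Category* C] [ModelCategory C] [HasZeroMorphisms C]
    [HasZeroObject C] {H : Type*} [Category* H] [Preadditive H] [HasZeroObject H]
    (L : C ⥤ H) [L.IsLocalization (weakEquivalences C)] [(suspension L).IsEquivalence]
    (X Y : SimplicialObject H) (f : X ⟶ Y) (n : ℕ) (hn : 1 ≤ n)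
    (S : Totalization L (gr 2 n ((alternatingFaceMapComplex H).obj X)))
    (T : Totalization L (gr 2 n ((alternatingFaceMapComplex H).obj Y))) :
    ∃ h : FilteredMap S T (grMap 2 n ((alternatingFaceMapComplex H).map f)),
      (∀ m : ℕ, IsIso (f.app (Opposite.op (SimplexCategory.mk m)))) → IsIso h.tot := by
  obtain ⟨h, hh⟩ := FilteredMap.exists_of_mono_proj S T
    (grMap 2 n ((alternatingFaceMapComplex H).map f)) (fun k ↦ by
      -- At `k = n - 1` the attaching map is the nontrivial one and `T.proj k` is still invertible;
      -- from `k = n` on, degree `k + 1` exceeds `n`.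
      by_cases hk : k < n
      · have := T.isIso_proj_of_lt k hk
        exact Or.inr inferInstance
      · exact Or.inl (isZero_grX _ (by lia)))
  exact ⟨h, fun hf ↦ hh (isIso_grMap_f 2 n _ hf) n⟩
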